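/- Let $p\ge 0$ be an integer, let $(\Omega,\mathcal F,P)$ be a probability space and let $u_n:\mathbb R^p\to\mathbb R^p$, $n\ge 1$, be random functions on it (estimating functions), i.e. $u_n(\theta)$ is a random vector for each $\theta\in\mathbb R^p$, such that $\theta\mapsto u_n(\theta)$ is differentiable. Put $J_n(\theta)=-\frac{\mathrm d}{\mathrm d\theta}u_n(\theta)$, the $p\times p$ matrix with entries $-\partial (u_n)_i/\partial\theta_j$. Let $\|\cdot\|$ denote the Euclidean norm of vectors and the corresponding operator norm of matrices, and let $\|A\|_M=\max_{i,j}|a_{ij}|$ for a matrix $A=[a_{ij}]$. Assume that there exist a (non-random) sequence of invertible symmetric real $p\times p$ matrices $V_n$ and a (non-random) sequence of parameter values $\theta_n^*\in\mathbb R^p$ such that: (G1) $\|V_n^{-1}\|\to 0$ as $n\to\infty$. (G2) There exists $l>0$ such that $P(l_n<l)\to 0$ as $n\to\infty$, where $l_n=\inf_{\|\phi\|=1}\phi^\top V_n^{-1}J_n(\theta_n^*)V_n^{-1}\phi$. (G3) For every $d>0$, $\gamma_{nd}=\sup_{\|V_n(\theta-\theta_n^*)\|\le d}\bigl\|V_n^{-1}\{J_n(\theta)-J_n(\theta_n^*)\}V_n^{-1}\bigr\|_M\to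 0$ in probability under $P$ as $n\to\infty$. (G4) The sequence $V_n^{-1}u_n(\theta_n^*)$ is bounded in probability: for each $\epsilon>0$ there exists $d$ such that $P(\|V_n^{-1}u_n(\theta_n^*)\|>d)\le\epsilon$ for all sufficiently large $n$. Then for each $\epsilon>0$ there exists $d>0$ such that, for all sufficiently large $n$, $$P\bigl\{\exists\,\tilde\theta_n\in\mathbb R^p:\ u_n(\tilde\theta_n)=0\ \text{ and }\ \|V_n(\tilde\theta_n-\theta_n^*)\|<d\bigr\}>1-\epsilon .$$ -/

import Mathlib

open MeasureTheory Filter Topology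

noncomputable section

/-- The entrywise maximum norm `max_{i,j} |a_{ij}|` of a square real matrix. -/
def matrixMaxNorm {p : ℕ} (A : Matrix (Fin p) (Fin p) ℝ) : ℝ :=
  ⨆ ij : Fin p × Fin p, |A ij.1 ij.2|

/-- The matrix-vector product `A x` on Euclidean space `ℝ^p`. -/
def matVec {p : ℕ} (A : Matrix (Fin p) (Fin p) ℝ) (x : EuclideanSpace ℝ (Fin p)) :
    EuclideanSpace ℝ (Fin p) :=
  Matrix.toEuclideanCLM (𝕜 := ℝ) A x

/-- The matrix `J(θ) = - d f / d θ`, with entries `- ∂ f_i / ∂ θ_j`. -/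
def negJacobian {p : ℕ} (f : EuclideanSpace ℝ (Fin p) → EuclideanSpace ℝ (Fin p))
    (θ : EuclideanSpace ℝ (Fin p)) : Matrix (Fin p) (Fin p) ℝ :=
  Matrix.of fun i j => -(fderiv ℝ f θ (EuclideanSpace.single j 1)) i

/-- The infimum of `φᵀ V⁻¹ J(θ₀) V⁻¹ φ` over unit vectors `φ`, where `J = - d f / d θ`
(as an extended real, so that no convention on infima of real sets is involved). -/
def lowerForm {p : ℕ} (f : EuclideanSpace ℝ (Fin p) → EuclideanSpace ℝ (Fin p))
    (V : Matrix (Fin p) (Fin p) ℝ) (θ₀ : EuclideanSpace ℝ (Fin p)) : EReal :=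
  ⨅ φ ∈ Metric.sphere (0 : EuclideanSpace ℝ (Fin p)) 1,
    ((inner ℝ φ (matVec (V⁻¹ * negJacobian f θ₀ * V⁻¹) φ) : ℝ) : EReal)

/-- The supremum of `‖V⁻¹ (J(θ) - J(θ₀)) V⁻¹‖_M` over all `θ` with `‖V (θ - θ₀)‖ ≤ d`
(possibly infinite). -/
def jacobianOscillation {p : ℕ} (f : EuclideanSpace ℝ (Fin p) → EuclideanSpace ℝ (Fin p))
    (V : Matrix (Fin p) (Fin p) ℝ) (θ₀ : EuclideanSpace ℝ (Fin p)) (d : ℝ) : ENNReal :=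
  ⨆ θ ∈ {θ : EuclideanSpace ℝ (Fin p) | ‖matVec V (θ - θ₀)‖ ≤ d},
    ENNReal.ofReal (matrixMaxNorm (V⁻¹ * (negJacobian f θ - negJacobian f θ₀) * V⁻¹))

end

open scoped NNReal

/-! The core is deterministic. In the coordinates `x = V (θ - θ₀)`, the map `g x = -V⁻¹ f (θ₀ + V⁻¹
x)` has the normalised Jacobian as derivative. Coercivity with constant `l` makes the derivative at
`0` invertible, with inverse of norm at most `l⁻¹`. If the derivative varies by at most `l / 2` on
the ball of radius `d`, the quantitative inverse function theorem shows that the image of this ball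
contains the ball of radius `(l - l / 2) d` about `g 0`, hence contains `0` once `‖g 0‖ ≤ l d / 2`
(`exists_zero_of_jacobianOscillation_le`). By G2, G3 and G4 these three conditions fail only with
small probability, and a union bound concludes. -/

theorem EuclideanSpace.norm_le_sum_abs {ι : Type*} [Fintype ι] (x : EuclideanSpace ℝ ι) :
    ‖x‖ ≤ ∑ i, |x i| := by
  rw [EuclideanSpace.norm_eq]
  apply Real.sqrt_le_iff.2 ⟨Finset.sum_nonneg fun i _ => abs_nonneg _, ?_⟩
  simpa only [Real.norm_eq_abs] using
    Finset.sum_sq_le_sq_sum_of_nonneg (s := Finset.univ) (f := fun i => |x i|)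
      fun i _ => abs_nonneg _

theorem abs_apply_le_matrixMaxNorm {p : ℕ} (A : Matrix (Fin p) (Fin p) ℝ) (i j : Fin p) :
    |A i j| ≤ matrixMaxNorm A :=
  le_ciSup (f := fun ij : Fin p × Fin p => |A ij.1 ij.2|) (Set.finite_range _).bddAbove (i, j)

theorem matrixMaxNorm_nonneg {p : ℕ} (A : Matrix (Fin p) (Fin p) ℝ) : 0 ≤ matrixMaxNorm A :=
  Real.iSup_nonneg fun _ => abs_nonneg _

theorem toEuclideanCLM_apply_apply {p : ℕ} (A : Matrix (Fin p) (Fin p) ℝ)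
    (x : EuclideanSpace ℝ (Fin p)) (i : Fin p) :
    Matrix.toEuclideanCLM (𝕜 := ℝ) A x i = ∑ j, A i j * x j := rfl

/-- The Euclidean operator norm is controlled by the entrywise maximum norm. -/
theorem norm_toEuclideanCLM_le_matrixMaxNorm {p : ℕ} (A : Matrix (Fin p) (Fin p) ℝ) :
    ‖Matrix.toEuclideanCLM (𝕜 := ℝ) A‖ ≤ (p : ℝ) ^ 2 * matrixMaxNorm A := by
  have h0 := matrixMaxNorm_nonneg A
  refine ContinuousLinearMap.opNorm_le_bound _ (by positivity) fun x => ?_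
  calc ‖Matrix.toEuclideanCLM (𝕜 := ℝ) A x‖
      ≤ ∑ i, |Matrix.toEuclideanCLM (𝕜 := ℝ) A x i| := EuclideanSpace.norm_le_sum_abs _
    _ ≤ ∑ _i : Fin p, ∑ _j : Fin p, matrixMaxNorm A * ‖x‖ := by
        refine Finset.sum_le_sum fun i _ => ?_
        rw [toEuclideanCLM_apply_apply]
        refine (Finset.abs_sum_le_sum_abs _ _).trans (Finset.sum_le_sum fun j _ => ?_)
        rw [abs_mul]
        exact mul_le_mul (abs_apply_le_matrixMaxNorm A i j) (PiLp.norm_apply_le x j)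
          (abs_nonneg _) h0
    _ = (p : ℝ) ^ 2 * matrixMaxNorm A * ‖x‖ := by
        simp only [Finset.sum_const, Finset.card_univ, Fintype.card_fin, nsmul_eq_mul]
        ring

theorem toEuclideanCLM_negJacobian {p : ℕ}
    (f : EuclideanSpace ℝ (Fin p) → EuclideanSpace ℝ (Fin p)) (θ : EuclideanSpace ℝ (Fin p)) :
    Matrix.toEuclideanCLM (𝕜 := ℝ) (negJacobian f θ) = -fderiv ℝ f θ := by
  ext x i
  have hx : x = ∑ j, x j • EuclideanSpace.single j (1 : ℝ) := by
    simpa using ((EuclideanSpace.basisFun (Fin p) ℝ).sum_repr x).symm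
  rw [toEuclideanCLM_apply_apply]
  conv_rhs => rw [hx]
  simp [negJacobian, mul_comm]

/-- The quadratic form of the normalised Jacobian is bounded below by any lower bound of
`lowerForm`. -/
theorem mul_norm_sq_le_inner_of_le_lowerForm {p : ℕ}
    {f : EuclideanSpace ℝ (Fin p) → EuclideanSpace ℝ (Fin p)}
    {V : Matrix (Fin p) (Fin p) ℝ} {θ₀ : EuclideanSpace ℝ (Fin p)} {l : ℝ}
    (h : (l : EReal) ≤ lowerForm f V θ₀) (x : EuclideanSpace ℝ (Fin p)) :
    l * ‖x‖ ^ 2 ≤ inner ℝ x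
      (Matrix.toEuclideanCLM (𝕜 := ℝ) (V⁻¹ * negJacobian f θ₀ * V⁻¹) x) := by
  rcases eq_or_ne x 0 with rfl | hx
  · simp
  have hx' : ‖x‖ ≠ 0 := norm_ne_zero_iff.2 hx
  have hmem : ‖x‖⁻¹ • x ∈ Metric.sphere (0 : EuclideanSpace ℝ (Fin p)) 1 := by
    simp [norm_smul, hx']
  have h1 := EReal.coe_le_coe_iff.1 (h.trans (iInf₂_le _ hmem))
  rw [matVec, map_smul, real_inner_smul_left, real_inner_smul_right] at h1
  calc l * ‖x‖ ^ 2 ≤ _ := mul_le_mul_of_nonneg_right h1 (sq_nonneg _)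
    _ = _ := by field_simp

/-- A coercive endomorphism of a finite-dimensional inner product space has a right inverse
bounded by the inverse of the coercivity constant. -/
theorem exists_nonlinearRightInverse_of_coercive {E : Type*} [NormedAddCommGroup E]
    [InnerProductSpace ℝ E] [FiniteDimensional ℝ E] (A : E →L[ℝ] E) {l : ℝ≥0} (hl : 0 < l)
    (hA : ∀ x, l * ‖x‖ ^ 2 ≤ inner ℝ x (A x)) :
    ∃ B : A.NonlinearRightInverse, B.nnnorm = l⁻¹ := by
  -- Cauchy–Schwarz turns coercivity into this bound. It gives injectivity, hence surjectivity in
  -- finite dimension, and also controls the inverse.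
  have hbound : ∀ x, ‖x‖ ≤ (l⁻¹ : ℝ≥0) * ‖A x‖ := by
    intro x
    rcases eq_or_ne x 0 with rfl | hx
    · simp
    have h1 := (hA x).trans (real_inner_le_norm x (A x))
    have hx' : 0 < ‖x‖ := norm_pos_iff.2 hx
    have h2 : (l : ℝ) * ‖x‖ ≤ ‖A x‖ := by
      refine le_of_mul_le_mul_left ?_ hx'
      linarith
    rw [NNReal.coe_inv, inv_mul_eq_div, le_div_iff₀ (by exact_mod_cast hl)]
    linarith
  have hinj : Function.Injective (A : E →ₗ[ℝ] E) := by
    rw [injective_iff_map_eq_zero]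
    intro x hx
    have h := hbound x
    rw [show A x = 0 from hx] at h
    simpa using h
  obtain ⟨B, hB⟩ := (LinearMap.injective_iff_surjective.1 hinj).hasRightInverse
  refine ⟨⟨B, l⁻¹, fun y => ?_, hB⟩, rfl⟩
  have h := hbound (B y)
  rwa [show A (B y) = y from hB y] at h

/-- If the normalised Jacobian is coercive at `θ₀`, oscillates little near `θ₀`, and the normalised
value at `θ₀` is not too large, then `f` has a zero near `θ₀`. -/
theorem exists_zero_of_jacobianOscillation_le {p : ℕ}
    {f : EuclideanSpace ℝ (Fin p) → EuclideanSpace ℝ (Fin p)} (hf : Differentiable ℝ f)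
    {V : Matrix (Fin p) (Fin p) ℝ} (hV : IsUnit V) {θ₀ : EuclideanSpace ℝ (Fin p)}
    {l d δ : ℝ} (hl : 0 < l) (hd : 0 ≤ d) (hδ : 0 ≤ δ) (hδl : (p : ℝ) ^ 2 * δ ≤ l / 2)
    (hlower : (l : EReal) ≤ lowerForm f V θ₀)
    (hosc : jacobianOscillation f V θ₀ d ≤ ENNReal.ofReal δ)
    (hval : ‖matVec V⁻¹ (f θ₀)‖ ≤ l / 2 * d) :
    ∃ θ, f θ = 0 ∧ ‖matVec V (θ - θ₀)‖ ≤ d := by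
  have hdet : IsUnit V.det := (Matrix.isUnit_iff_isUnit_det V).1 hV
  set W := Matrix.toEuclideanCLM (𝕜 := ℝ) V⁻¹ with hW
  have hVW : ∀ x, Matrix.toEuclideanCLM (𝕜 := ℝ) V (W x) = x := fun x => by
    rw [hW, ← mul_apply_eq_comp, ← map_mul, Matrix.mul_nonsing_inv V hdet, map_one]
    rfl
  let A : EuclideanSpace ℝ (Fin p) → EuclideanSpace ℝ (Fin p) →L[ℝ] EuclideanSpace ℝ (Fin p) :=
    fun θ => Matrix.toEuclideanCLM (𝕜 := ℝ) (V⁻¹ * negJacobian f θ * V⁻¹)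
  have hAeq : ∀ θ, A θ = -(W ∘L fderiv ℝ f θ ∘L W) := fun θ => by
    simp only [A]
    rw [map_mul, map_mul, toEuclideanCLM_negJacobian, ← hW]
    ext x
    simp
  let g : EuclideanSpace ℝ (Fin p) → EuclideanSpace ℝ (Fin p) := fun x => -W (f (θ₀ + W x))
  have hg : ∀ x, HasFDerivAt g (A (θ₀ + W x)) x := fun x => by
    rw [hAeq]
    exact (W.hasFDerivAt.comp x
      ((hf (θ₀ + W x)).hasFDerivAt.comp x (W.hasFDerivAt.const_add θ₀))).neg
  have hball : ∀ x ∈ Metric.closedBall (0 : EuclideanSpace ℝ (Fin p)) d,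
      ‖A (θ₀ + W x) - A θ₀‖ ≤ l / 2 := fun x hx => by
    have hmem : θ₀ + W x ∈ {θ : EuclideanSpace ℝ (Fin p) | ‖matVec V (θ - θ₀)‖ ≤ d} := by
      rw [Set.mem_ofPred_eq, add_sub_cancel_left, matVec, hVW]
      simpa using hx
    have h1 : matrixMaxNorm (V⁻¹ * (negJacobian f (θ₀ + W x) - negJacobian f θ₀) * V⁻¹) ≤ δ :=
      (ENNReal.ofReal_le_ofReal_iff hδ).1 ((le_iSup₂ (f := fun θ _ => ENNReal.ofReal
        (matrixMaxNorm (V⁻¹ * (negJacobian f θ - negJacobian f θ₀) * V⁻¹))) _ hmem).trans hosc)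
    have h2 : A (θ₀ + W x) - A θ₀ = Matrix.toEuclideanCLM (𝕜 := ℝ)
        (V⁻¹ * (negJacobian f (θ₀ + W x) - negJacobian f θ₀) * V⁻¹) := by
      simp only [A]
      rw [← map_sub, mul_sub, sub_mul]
    rw [h2]
    exact (norm_toEuclideanCLM_le_matrixMaxNorm _).trans
      ((mul_le_mul_of_nonneg_left h1 (sq_nonneg _)).trans hδl)
  lift l to ℝ≥0 using hl.le
  -- Mean value inequality on the convex ball.
  have happrox : ApproximatesLinearOn g (A θ₀) (Metric.closedBall 0 d) (l / 2) :=
    fun x hx y hy => by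
      simpa using (convex_closedBall (0 : EuclideanSpace ℝ (Fin p))
        d).norm_image_sub_le_of_norm_hasFDerivWithin_le'
        (fun z _ => (hg z).hasFDerivWithinAt) hball hy hx
  obtain ⟨B, hB⟩ := exists_nonlinearRightInverse_of_coercive (A θ₀)
    (by exact_mod_cast hl) (mul_norm_sq_le_inner_of_le_lowerForm hlower)
  have hsurj := happrox.surjOn_closedBall_of_nonlinearRightInverse B hd subset_rfl
  have h0 : (0 : EuclideanSpace ℝ (Fin p)) ∈
      Metric.closedBall (g 0) (((B.nnnorm : ℝ)⁻¹ - (l / 2 : ℝ≥0)) * d) := by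
    rw [hB, mem_closedBall_iff_norm, zero_sub, norm_neg]
    simp only [g, map_zero, add_zero, norm_neg]
    refine hval.trans_eq ?_
    push_cast
    rw [inv_inv]
    ring
  obtain ⟨x, hx, hx0⟩ := hsurj h0
  refine ⟨θ₀ + W x, ?_, ?_⟩
  -- Applying `V` cancels the outer `V⁻¹` in `g x = 0`.
  · have h := congrArg (Matrix.toEuclideanCLM (𝕜 := ℝ) V) hx0
    simpa [g, hVW] using h
  · rw [add_sub_cancel_left, matVec, hVW]
    simpa using hx

theorem mainTheorem4 {Ω : Type*} [MeasurableSpace Ω] (P : Measure Ω) [IsProbabilityMeasure P]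
    {p : ℕ}
    -- the estimating functions: random functions `ℝ^p → ℝ^p`, differentiable in the parameter
    (u : ℕ → Ω → EuclideanSpace ℝ (Fin p) → EuclideanSpace ℝ (Fin p))
    (hu_meas : ∀ n θ, Measurable fun ω => u n ω θ)
    (hu_diff : ∀ n ω, Differentiable ℝ (u n ω))
    -- the normalising matrices and the parameter values
    (V : ℕ → Matrix (Fin p) (Fin p) ℝ)
    (hV_symm : ∀ n, (V n).IsSymm)
    (hV_inv : ∀ n, IsUnit (V n))
    (θs : ℕ → EuclideanSpace ℝ (Fin p))
    (G1 : Tendsto (fun n => ‖Matrix.toEuclideanCLM (𝕜 := ℝ) (V n)⁻¹‖) atTop (𝓝 0))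
    (G2 : ∃ l : ℝ, 0 < l ∧
      Tendsto (fun n => P {ω | lowerForm (u n ω) (V n) (θs n) < (l : EReal)}) atTop (𝓝 0))
    (G3 : ∀ d : ℝ, 0 < d → ∀ δ : ℝ, 0 < δ →
      Tendsto (fun n => P {ω | ENNReal.ofReal δ < jacobianOscillation (u n ω) (V n) (θs n) d})
        atTop (𝓝 0))
    (G4 : ∀ ε : ℝ, 0 < ε → ∃ d : ℝ, ∀ᶠ n in atTop,
      P.real {ω | d < ‖matVec (V n)⁻¹ (u n ω (θs n))‖} ≤ ε) :
    ∀ ε : ℝ, 0 < ε → ∃ d : ℝ, 0 < d ∧ ∀ᶠ n in atTop,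
      1 - ε < P.real {ω | ∃ θ : EuclideanSpace ℝ (Fin p),
        u n ω θ = 0 ∧ ‖matVec (V n) (θ - θs n)‖ < d} := by
  intro ε hε
  obtain ⟨l, hl, hG2⟩ := G2
  -- Three exceptional events of probability at most `ε / 4` leave strict room below `ε`.
  obtain ⟨d₀, hG4⟩ := G4 (ε / 4) (by positivity)
  have hε4 : (0 : ENNReal) < ENNReal.ofReal (ε / 4) := ENNReal.ofReal_pos.2 (by positivity)
  have toReal_le : ∀ s : Set Ω, P s < ENNReal.ofReal (ε / 4) → P.real s ≤ ε / 4 := fun s hs =>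
    ENNReal.toReal_le_of_le_ofReal (by positivity) hs.le
  -- Chosen so that `l / 2 * d = |d₀|`; the sign of `d₀` is unknown.
  set d := 2 * |d₀| / l with hd_def
  have hd : 0 ≤ d := by positivity
  -- The factor `p ^ 2` is the cost of passing from the maximum norm to the operator norm; the `+ 1`
  -- covers `p = 0`.
  set δ := l / (2 * ((p : ℝ) ^ 2 + 1)) with hδ_def
  have hδ : 0 < δ := by positivity
  have hδl : (p : ℝ) ^ 2 * δ ≤ l / 2 := by
    have h : ((p : ℝ) ^ 2 + 1) * δ = l / 2 := by rw [hδ_def]; field_simp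
    linarith
  -- The core result gives `≤ d`, where `d` may be `0`; the extra `1` makes the radius positive and
  -- the inequality strict.
  refine ⟨d + 1, by positivity, ?_⟩
  filter_upwards [hG4, hG2.eventually_lt_const hε4,
    (G3 (d + 1) (by positivity) δ hδ).eventually_lt_const hε4] with n h4 h2 h3
  set good := {ω | ∃ θ : EuclideanSpace ℝ (Fin p),
    u n ω θ = 0 ∧ ‖matVec (V n) (θ - θs n)‖ < d + 1}
  set bad₂ := {ω | lowerForm (u n ω) (V n) (θs n) < (l : EReal)}
  set bad₃ := {ω | ENNReal.ofReal δ < jacobianOscillation (u n ω) (V n) (θs n) (d + 1)}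
  set bad₄ := {ω | d₀ < ‖matVec (V n)⁻¹ (u n ω (θs n))‖}
  -- Covering the whole space needs only subadditivity, so measurability of these events plays no
  -- role.
  have hcover : Set.univ ⊆ good ∪ (bad₂ ∪ (bad₃ ∪ bad₄)) := fun ω _ => by
    by_contra hω
    simp only [Set.mem_union, not_or] at hω
    obtain ⟨hgood, h2, h3, h4⟩ := hω
    have hval : ‖matVec (V n)⁻¹ (u n ω (θs n))‖ ≤ l / 2 * d :=
      calc _ ≤ d₀ := not_lt.1 h4
        _ ≤ |d₀| := le_abs_self _
        _ = l / 2 * d := by rw [hd_def]; field_simp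
    have hosc : jacobianOscillation (u n ω) (V n) (θs n) d ≤ ENNReal.ofReal δ :=
      (biSup_mono fun θ (hθ : _ ≤ d) => hθ.trans (by linarith)).trans (not_lt.1 h3)
    obtain ⟨θ, hθ, hθd⟩ := exists_zero_of_jacobianOscillation_le (hu_diff n ω) (hV_inv n) hl hd
      hδ.le hδl (not_lt.1 h2) hosc hval
    exact hgood ⟨θ, hθ, by linarith⟩
  have hsum : 1 ≤ P.real good + (P.real bad₂ + (P.real bad₃ + P.real bad₄)) :=
    calc (1 : ℝ) = P.real Set.univ := by simp
      _ ≤ P.real (good ∪ (bad₂ ∪ (bad₃ ∪ bad₄))) := measureReal_mono hcover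
      _ ≤ _ := (measureReal_union_le _ _).trans <| by
        gcongr
        refine (measureReal_union_le _ _).trans ?_
        gcongr
        exact measureReal_union_le _ _
  have := toReal_le _ h2
  have := toReal_le _ h3
  linarith
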